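/- Consider episodic fixed-horizon MDPs $M=(\mathcal S,\mathcal A,r,p,p_0,H)$ with finite nonempty $\mathcal S,\mathcal A$, a stationary transition kernel $p$, an initial distribution $p_0$ and mean rewards $r_t(s)\in[0,1]$. For a deterministic, possibly time-dependent policy $\pi$ let $R^\pi_M=\mathbb E\big[\sum_{t=1}^H r_t(s_t)\big]$ (with $a_t=\pi_t(s_t)$) and $R^*_M=\max_\pi R^\pi_M$. A (possibly randomized) algorithm $A$, which knows everything but $p$, observes episodes of $M$, may stop after any number $n_A\in\{0,1,2,\dots\}\cup\{\infty\}$ of episodes, depending on what it has observed, and then outputs a deterministic policy $\pi$. It is $(\epsilon,\delta)$-PAC for given $\mathcal S,\mathcal A,H$ if in every such MDP it stops and outputs a policy with $R^\pi_M\ge R^*_M-\epsilon$ with probability at least $1-\delta$. Let $\delta_0=\frac{e^{-4}}{80}$, $c_2=4$, $c_3=\frac{e^{-4}}{80}$ and, for a horizon $H$, $\epsilon_0=\frac{H-2}{640e^4}$. There are universal constants $c_1,c_1'>0$ such that for all $\mathcal S,\mathcal A,H$, all $\delta\in(0,\delta_0)$ and $\epsilon\in(0,\epsilon_0)$, and every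 algorithm $A$ that is $(\epsilon,\delta)$-PAC for $\mathcal S,\mathcal A,H$ and outputs a deterministic policy, there is a fixed-horizon episodic MDP $M_{hard}$ with state space $\mathcal S$, action space $\mathcal A$ and horizon $H$ on which $$\mathbb E[n_A]\;\ge\;\frac{c_1(H-2)^2(|\mathcal A|-1)(|\mathcal S|-3)}{\epsilon^2}\,\ln\!\Big(\frac{c_2}{\delta+c_3}\Big),$$ and, if $|\mathcal S|\ge4$ and $|\mathcal A|\ge2$, also $$\mathbb E[n_A]\;\ge\;c_1'\,\frac{|\mathcal S\times\mathcal A|\,H^2}{\epsilon^2}\,\ln\!\Big(\frac{c_2}{\delta+c_3}\Big).$$ If $|\mathcal S|\ge4$, then $M_{hard}$ can be taken to be a collection of $|\mathcal S|-3$ parallel multi-armed bandits: each episode starts in a fixed state, moves, whatever the action, to one of $|\mathcal S|-3$ bandit states chosen uniformly, and from there, with a probability that depends on the bandit state and the action, either to an absorbing state with reward $1$ in every step or to an absorbing state with reward $0$; all other rewards are $0$. -/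

import Mathlib

open MeasureTheory ProbabilityTheory
open scoped ENNReal

universe u v

/-- A fixed-horizon episodic MDP with state space `S`, action space `A` and horizon `H`:
mean rewards `r t s` in `[0,1]` (which may depend on the time step; `t : Fin H` counts the steps
from `0`), a stationary transition kernel `p` and an initial distribution `p0`. -/
structure FHMDP (S : Type u) (A : Type v) (H : ℕ) where
  r : Fin H → S → ℝ
  r_nonneg : ∀ t s, 0 ≤ r t s
  r_le_one : ∀ t s, r t s ≤ 1
  p : S → A → PMF S
  p0 : PMF S

/-- Deterministic, possibly time-dependent policies: `a_t = π_t(s_t)`. -/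
abbrev DetPolicy (S : Type u) (A : Type v) (H : ℕ) := Fin H → S → A

/-- What is observed in one episode: the state-action pairs `(s_1, a_1), …, (s_H, a_H)` and the
state that follows the last action. -/
abbrev Episode (S : Type u) (A : Type v) := List (S × A) × S

namespace FHMDP

variable {S : Type u} {A : Type v} {H : ℕ}

/-- The law of the state at time step `t` when the policy `π` is followed. -/
noncomputable def stateLaw (M : FHMDP S A H) (π : DetPolicy S A H) : (t : ℕ) → t < H → PMF S
  | 0, _ => M.p0
  | t + 1, h =>
      (stateLaw M π t (Nat.lt_of_succ_lt h)).bind fun s =>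
        M.p s (π ⟨t, Nat.lt_of_succ_lt h⟩ s)

/-- The total expected reward `R^π = E[∑ₜ r_t(s_t)]` of an episode under the policy `π`. -/
noncomputable def expReturn [Fintype S] (M : FHMDP S A H) (π : DetPolicy S A H) : ℝ :=
  ∑ t : Fin H, ∑ s : S, (M.stateLaw π t t.isLt s).toReal * M.r t s

/-- The optimal total expected reward `R^*`, a maximum over the finitely many policies. -/
noncomputable def optReturn [Fintype S] (M : FHMDP S A H) : ℝ :=
  ⨆ π : DetPolicy S A H, M.expReturn π

/-- `π` is `ε`-optimal: not `R^* - ε > R^π`. -/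
def IsEpsOptimal [Fintype S] (M : FHMDP S A H) (ε : ℝ) (π : DetPolicy S A H) : Prop :=
  M.optReturn - ε ≤ M.expReturn π

/-- The remaining `k` steps of an episode, in which the pairs in `e` have been observed and `s` is
the current state, when actions are drawn from `b` (given the observed pairs and the current
state). -/
noncomputable def rollout (M : FHMDP S A H) (b : List (S × A) → S → PMF A) :
    ℕ → List (S × A) → S → PMF (Episode S A)
  | 0, e, s => PMF.pure (e, s)
  | k + 1, e, s =>
      (b e s).bind fun a => (M.p s a).bind fun s' => rollout M b k (e ++ [(s, a)]) s'

/-- The law of a whole episode of `H` steps with action choice `b`. -/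
noncomputable def episodeLaw (M : FHMDP S A H) (b : List (S × A) → S → PMF A) :
    PMF (Episode S A) :=
  M.p0.bind fun s => M.rollout b H [] s

/-- `M` consists of `|S| - 3` parallel Bernoulli bandits. Every episode starts in `start`; whatever
action is taken there, the next state is uniform among the other states `i` that differ from `good`
and `bad`; from such an `i`, the action `a` leads to `good` or to `bad`; these two are absorbing,
and only `good` carries reward, namely `1` in every time step. -/
def IsParallelBandits [Fintype S] (M : FHMDP S A H) : Prop :=
  ∃ start good bad : S, start ≠ good ∧ start ≠ bad ∧ good ≠ bad ∧
    M.p0 = PMF.pure start ∧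
    (∀ t, M.r t good = 1) ∧
    (∀ t s, s ≠ good → M.r t s = 0) ∧
    (∀ a i, i ≠ start → i ≠ good → i ≠ bad →
      (M.p start a i).toReal = 1 / ((Fintype.card S : ℝ) - 3)) ∧
    (∀ i a, i ≠ start → i ≠ good → i ≠ bad → M.p i a good + M.p i a bad = 1) ∧
    (∀ a, M.p good a = PMF.pure good) ∧
    (∀ a, M.p bad a = PMF.pure bad)

end FHMDP

/-- A learner that interacts with an unknown MDP in episodes, possibly randomized. `act h e s` is
the law of the next action when the complete episodes `h` have been observed before, the pairs `e`
in the current episode, and the current state is `s`. After the complete episodes `h`, `decide h`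
is the law of the decision to go on for another episode (`none`) or to stop and output the
deterministic policy `π` (`some π`). -/
structure Learner (S : Type u) (A : Type v) (H : ℕ) where
  act : List (Episode S A) → List (S × A) → S → PMF A
  decide : List (Episode S A) → PMF (Option (DetPolicy S A H))

/-- The status of the interaction: the complete episodes so far, and the policy that has been
output, if the learner has stopped. -/
structure Status (S : Type u) (A : Type v) (H : ℕ) where
  episodes : List (Episode S A)
  output : Option (DetPolicy S A H)

instance Status.instMeasurableSpace (S : Type u) (A : Type v) (H : ℕ) :
    MeasurableSpace (Status S A H) := ⊤

namespace Learner

variable {S : Type u} {A : Type v} {H : ℕ}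

/-- One round of the interaction: a learner that has not stopped decides whether to stop; if it
goes on, one more episode is sampled. After stopping the status does not change. -/
noncomputable def round (L : Learner S A H) (M : FHMDP S A H) : Status S A H → PMF (Status S A H)
  | ⟨h, some π⟩ => PMF.pure ⟨h, some π⟩
  | ⟨h, none⟩ => (L.decide h).bind fun d =>
      match d with
      | some π => PMF.pure ⟨h, some π⟩
      | none => (M.episodeLaw (L.act h)).map fun e => ⟨h ++ [e], none⟩

/-- `round` as the transition kernel from the statuses up to round `k` to the next status. -/
noncomputable def roundKernel (L : Learner S A H) (M : FHMDP S A H) (k : ℕ) :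
    Kernel (Π _ : Finset.Iic k, Status S A H) (Status S A H) where
  toFun x := (L.round M (x ⟨k, Finset.mem_Iic.2 le_rfl⟩)).toMeasure
  measurable' := (measurable_from_top (f := fun x => (L.round M x).toMeasure)).comp
    (measurable_pi_apply _)

instance roundKernel.instIsMarkovKernel (L : Learner S A H) (M : FHMDP S A H) (k : ℕ) :
    IsMarkovKernel (L.roundKernel M k) :=
  ⟨fun x => PMF.toMeasure.isProbabilityMeasure (L.round M (x ⟨k, Finset.mem_Iic.2 le_rfl⟩))⟩

/-- The probability measure `P` of the interaction of the learner `L` with the MDP `M`: the law of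
the Markov chain of statuses that starts without episodes and without output. -/
noncomputable def interactionLaw (L : Learner S A H) (M : FHMDP S A H) :
    Measure (ℕ → Status S A H) :=
  Kernel.traj (X := fun _ => Status S A H) (L.roundKernel M) 0 (fun _ => ⟨[], none⟩)

/-- The number of episodes observed before stopping, `∞` if the learner never stops. -/
noncomputable def numEpisodes (ω : ℕ → Status S A H) : ℝ≥0∞ :=
  ⨆ k, ((ω k).episodes.length : ℝ≥0∞)

/-- The expected number `E[n]` of episodes before the learner stops. -/
noncomputable def expNumEpisodes (L : Learner S A H) (M : FHMDP S A H) : ℝ≥0∞ :=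
  ∫⁻ ω, numEpisodes ω ∂(L.interactionLaw M)

end Learner

/-- A learning algorithm for state space `S`, action space `A` and horizon `H`. It knows the reward
function and the initial distribution of the MDP, but not the transition kernel. -/
abbrev Algorithm (S : Type u) (A : Type v) (H : ℕ) :=
  (Fin H → S → ℝ) → PMF S → Learner S A H

/-- The algorithm is `(ε, δ)`-PAC: in every MDP, with probability at least `1 - δ` it stops and
outputs an `ε`-optimal policy. -/
def Algorithm.IsPAC {S : Type u} {A : Type v} {H : ℕ} [Fintype S]
    (alg : Algorithm S A H) (ε δ : ℝ) : Prop :=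
  ∀ M : FHMDP S A H,
    ENNReal.ofReal (1 - δ) ≤ (alg M.r M.p0).interactionLaw M
      {ω | ∃ k π, (ω k).output = some π ∧ M.IsEpsOptimal ε π}

/-! The hard instances are parallel bandits in which every arm succeeds with probability `1/2`,
except that each bandit may hide one arm with probability `1/2 + gap`, where `gap = 16 ε / (H - 2)`.
A missed hidden arm costs `(H - 2) * gap / n` of return, with `n` the number of bandits, so an
`ε`-optimal policy misses at most `n / 16` of them (`card_missed_le`). All instances share rewards
and initial law, so one learner faces them all.

Fix a bandit and compare the instance where it hides no arm with those where it hides `a`. The two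
differ in one transition law, and `close_statusLaw` bounds the effect on the learner's history by `5
* gap ^ 2` times the expected number of pulls of `a`, counted under the instance without hidden arm.
There the learner misses at least `|A| - 1` arms on average, as it outputs at most one
(`card_le_missProb`). Hence either hidden arms are missed often or the bandit is pulled about `|A| /
gap ^ 2` times (`card_le_add`). Averaging over all configurations `θ` and summing over bandits gives
the bound, because an episode contains at most one pull (`sum_visits_le_length`).

Instead of Kullback-Leibler divergence, the relation `PMF.Close` is used: it has a chain rule and
needs no logarithms or absolute continuity. The logarithm in the claim is at most `10`
(`log_confidence_le`), so a constant-probability argument suffices. -/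

namespace PMF

/-! ### Expectations under probability mass functions. -/

variable {α β γ : Type*}

/-- The expectation of an extended nonnegative function under a probability mass function. -/
noncomputable def expect (p : PMF α) (f : α → ℝ≥0∞) : ℝ≥0∞ := ∑' x, p x * f x

theorem expect_pure (a : α) (f : α → ℝ≥0∞) : (PMF.pure a).expect f = f a := by
  classical
  unfold expect
  rw [tsum_eq_single a]
  · simp
  · intro b hb
    simp [PMF.pure_apply, hb]

theorem expect_bind (p : PMF α) (k : α → PMF β) (f : β → ℝ≥0∞) :
    (p.bind k).expect f = p.expect fun x => (k x).expect f := by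
  unfold expect
  simp only [PMF.bind_apply, ← ENNReal.tsum_mul_left, ← ENNReal.tsum_mul_right]
  rw [ENNReal.tsum_comm]
  simp only [mul_assoc]

theorem expect_map (p : PMF α) (g : α → β) (f : β → ℝ≥0∞) :
    (p.map g).expect f = p.expect fun x => f (g x) := by
  rw [PMF.map, expect_bind]
  simp [expect_pure]

theorem expect_mono_support (p : PMF α) {f g : α → ℝ≥0∞} (h : ∀ x ∈ p.support, f x ≤ g x) :
    p.expect f ≤ p.expect g := by
  refine ENNReal.tsum_le_tsum fun x => ?_
  by_cases hx : x ∈ p.support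
  · exact mul_le_mul_right (h x hx) _
  · simp [(p.apply_eq_zero_iff x).2 hx]

theorem expect_mono (p : PMF α) {f g : α → ℝ≥0∞} (h : ∀ x, f x ≤ g x) :
    p.expect f ≤ p.expect g := p.expect_mono_support fun x _ => h x

theorem expect_add (p : PMF α) (f g : α → ℝ≥0∞) :
    (p.expect fun x => f x + g x) = p.expect f + p.expect g := by
  simp [expect, mul_add, ENNReal.tsum_add]

theorem expect_mul_left (p : PMF α) (c : ℝ≥0∞) (f : α → ℝ≥0∞) :
    (p.expect fun x => c * f x) = c * p.expect f := by
  simp only [expect, ← ENNReal.tsum_mul_left]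
  exact tsum_congr fun x => mul_left_comm _ _ _

theorem expect_const (p : PMF α) (c : ℝ≥0∞) : (p.expect fun _ => c) = c := by
  simp [expect, ENNReal.tsum_mul_right, p.tsum_coe]

theorem expect_finset_sum {ι : Type*} (p : PMF α) (s : Finset ι) (f : ι → α → ℝ≥0∞) :
    (p.expect fun x => ∑ i ∈ s, f i x) = ∑ i ∈ s, p.expect (f i) := by
  classical
  induction s using Finset.induction_on with
  | empty => simpa using p.expect_const 0
  | insert i s hi ih => simp [Finset.sum_insert hi, expect_add, ih]

theorem expect_le_one (p : PMF α) {f : α → ℝ≥0∞} (h : ∀ x, f x ≤ 1) : p.expect f ≤ 1 :=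
  (p.expect_mono h).trans (p.expect_const 1).le

theorem sq_expect_le (p : PMF α) (f : α → ℝ≥0∞) :
    p.expect f ^ 2 ≤ p.expect fun x => f x ^ 2 := by
  have two_mul_le : ∀ a b : ℝ≥0∞, 2 * (a * b) ≤ a ^ 2 + b ^ 2 := by
    intro a b
    rcases eq_or_ne a ⊤ with rfl | ha
    · simp
    rcases eq_or_ne b ⊤ with rfl | hb
    · simp
    lift a to NNReal using ha
    lift b to NNReal using hb
    have : 2 * (a * b) ≤ a ^ 2 + b ^ 2 := by
      have := two_mul_le_add_sq (a : ℝ) b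
      rw [← NNReal.coe_le_coe]; push_cast; linarith
    exact_mod_cast this
  have h : 2 * p.expect f ^ 2 ≤ 2 * p.expect fun x => f x ^ 2 := by
    -- Jensen's inequality by doubling: write the square with two independent copies and apply the
    -- arithmetic-geometric mean inequality pointwise.
    calc 2 * p.expect f ^ 2 = p.expect fun x => p.expect fun y => 2 * (f x * f y) := by
          simp only [expect_mul_left]
          rw [show (p.expect fun x => f x * p.expect f) = p.expect fun x => p.expect f * f x from
            by simp only [mul_comm], expect_mul_left, sq]
      _ ≤ p.expect fun x => p.expect fun y => f x ^ 2 + f y ^ 2 :=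
          p.expect_mono fun x => p.expect_mono fun y => two_mul_le _ _
      _ = 2 * p.expect fun x => f x ^ 2 := by
          simp only [expect_add, expect_const, two_mul]
  exact (ENNReal.mul_le_mul_iff_right (by simp) (by simp)).1 h

theorem lintegral_toMeasure [Countable α] [MeasurableSpace α] [MeasurableSingletonClass α]
    (p : PMF α) (f : α → ℝ≥0∞) : ∫⁻ x, f x ∂p.toMeasure = p.expect f := by
  rw [lintegral_countable']
  exact tsum_congr fun x => by
    rw [p.toMeasure_apply_singleton _ (measurableSet_singleton x), mul_comm]

theorem toMeasure_eq_expect_indicator [MeasurableSpace α] (p : PMF α) {s : Set α}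
    (hs : MeasurableSet s) : p.toMeasure s = p.expect (s.indicator 1) := by
  rw [p.toMeasure_apply hs]
  refine tsum_congr fun x => ?_
  by_cases hx : x ∈ s <;> simp [hx]

/-! ### Change of measure. -/

/-- A change-of-measure bound: expectations of `[0,1]`-valued functions under `p` are controlled by
expectations under `q` through the concave function `v ↦ 2 v - v ^ 2`, up to the error `c`.
It plays the role of a bound on the Kullback-Leibler divergence. -/
def Close (p q : PMF α) (c : ℝ≥0∞) : Prop :=
  ∀ f : α → ℝ≥0∞, (∀ x, f x ≤ 1) →
    2 * p.expect f + q.expect f ^ 2 ≤ 2 * q.expect f + (p.expect fun x => f x ^ 2) + c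

theorem Close.refl (p : PMF α) : p.Close p 0 := fun f _ => by
  rw [add_zero]
  gcongr
  exact p.sq_expect_le f

/-- The chain rule. -/
theorem Close.bind {p q : PMF α} {k l : α → PMF β} {c : ℝ≥0∞} {d : α → ℝ≥0∞}
    (h : p.Close q c) (hkl : ∀ x, (k x).Close (l x) (d x)) :
    (p.bind k).Close (q.bind l) (c + p.expect d) := by
  intro f hf
  set w : α → ℝ≥0∞ := fun x => (l x).expect f with hw
  have hw1 : ∀ x, w x ≤ 1 := fun x => (l x).expect_le_one hf
  have h1 := h w hw1
  have h2 : 2 * (p.expect fun x => (k x).expect f) + (p.expect fun x => w x ^ 2) ≤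
      2 * p.expect w + (p.expect fun x => (k x).expect fun y => f y ^ 2) + p.expect d := by
    have := p.expect_mono fun x => hkl x f hf
    simpa only [expect_add, expect_mul_left] using this
  simp only [expect_bind]
  have hfin : 2 * p.expect w + (p.expect fun x => w x ^ 2) ≠ ⊤ := by
    have a1 : p.expect w ≠ ⊤ := ne_top_of_le_ne_top ENNReal.one_ne_top (p.expect_le_one hw1)
    have a2 : (p.expect fun x => w x ^ 2) ≠ ⊤ :=
      ne_top_of_le_ne_top ENNReal.one_ne_top (p.expect_le_one fun x => pow_le_one₀ (zero_le) (hw1 x))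
    exact ENNReal.add_ne_top.2 ⟨ENNReal.mul_ne_top (by simp) a1, a2⟩
  -- The inequality for `p`, `q` tested on `w` and the averaged inequality for the kernels share
  -- these intermediate terms, which cancel because they are finite.
  refine (ENNReal.add_le_add_iff_left hfin).1 ?_
  calc _ = (2 * (p.expect fun x => (k x).expect f) + (p.expect fun x => w x ^ 2)) +
        (2 * p.expect w + q.expect w ^ 2) := by ring
    _ ≤ _ := add_le_add h2 h1
    _ = _ := by ring

theorem Close.map {p q : PMF α} {c : ℝ≥0∞} (h : p.Close q c) (g : α → β) :
    (p.map g).Close (q.map g) c := by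
  have := h.bind (fun x => Close.refl (PMF.pure (g x)))
  rw [expect_const, add_zero] at this
  exact this

/-- An indicator equals its square, so one of the two copies of the `p`-probability cancels and the
square of the `q`-probability can be dropped. -/
theorem Close.prob_le {p q : PMF α} {c : ℝ≥0∞} (h : p.Close q c) (s : Set α) :
    p.expect (s.indicator 1) ≤ 2 * q.expect (s.indicator 1) + c := by
  have hs : ∀ x, (s.indicator 1 : α → ℝ≥0∞) x ≤ 1 := fun x => by
    by_cases hx : x ∈ s <;> simp [hx]
  have h1 := h (s.indicator 1) hs
  have h2 : (fun x => (s.indicator 1 : α → ℝ≥0∞) x ^ 2) = s.indicator 1 := by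
    funext x
    by_cases hx : x ∈ s <;> simp [hx]
  rw [h2] at h1
  refine (ENNReal.add_le_add_iff_left
    (ne_top_of_le_ne_top ENNReal.one_ne_top (p.expect_le_one hs))).1 ?_
  calc _ ≤ 2 * p.expect (s.indicator 1) + q.expect (s.indicator 1) ^ 2 := by
        rw [← two_mul]; exact le_self_add
    _ ≤ _ := h1
    _ = _ := by ring

/-- A coin that shows `true` with probability `x`. -/
noncomputable def coin (x : NNReal) (hx : x ≤ 1) : PMF Bool :=
  PMF.ofFintype (fun b => ((cond b x (1 - x) : NNReal) : ℝ≥0∞)) (by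
    rw [Fintype.sum_bool]
    exact_mod_cast add_tsub_cancel_of_le hx)

theorem expect_coin (x : NNReal) (hx : x ≤ 1) (f : Bool → ℝ≥0∞) :
    (PMF.coin x hx).expect f = x * f true + ((1 - x : NNReal) : ℝ≥0∞) * f false := by
  simp [expect, tsum_fintype, coin, PMF.ofFintype_apply]

theorem close_coin_half {g : ℝ} (hg : 0 ≤ g) (hg' : g ≤ 1 / 8) {x y : NNReal} (hx : x ≤ 1)
    (hy : y ≤ 1) (hxv : (x : ℝ) = 1 / 2) (hyv : (y : ℝ) = 1 / 2 + g) :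
    (PMF.coin x hx).Close (PMF.coin y hy) (ENNReal.ofReal (5 * g ^ 2)) := by
  intro f hf
  simp only [expect_coin]
  have ht := hf true
  have hb := hf false
  generalize f true = a at *
  generalize f false = b at *
  lift a to NNReal using ne_top_of_le_ne_top ENNReal.one_ne_top ht
  lift b to NNReal using ne_top_of_le_ne_top ENNReal.one_ne_top hb
  have ha1 : (a : ℝ) ≤ 1 := by exact_mod_cast ht
  have hb1 : (b : ℝ) ≤ 1 := by exact_mod_cast hb
  have ha0 := a.coe_nonneg
  have hb0 := b.coe_nonneg
  rw [ENNReal.ofReal]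
  norm_cast
  rw [← NNReal.coe_le_coe]
  push_cast [NNReal.coe_sub hx, NNReal.coe_sub hy]
  rw [Real.coe_toNNReal _ (by positivity), hxv, hyv]
  generalize (a : ℝ) = a at *
  generalize (b : ℝ) = b at *
  -- The claim as a quadratic in `a - b`. Its discriminant is nonpositive since `5 * (1 / 4 - g ^ 2)
  -- ≥ 1` for `g ≤ 1 / 8`; this is where the constant `5` comes from.
  have key : (a - b) ^ 2 * (1 / 4 - g ^ 2) + 2 * g * (a - b) * (1 - (a + b) / 2) + 5 * g ^ 2 ≥ 0 := by
    have hm : 0 ≤ 1 - (a + b) / 2 := by linarith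
    have hm1 : 1 - (a + b) / 2 ≤ 1 := by linarith
    set m := 1 - (a + b) / 2
    set h := a - b
    have h1 : 0 ≤ (h / (9/4) + (9/4) * g * m) ^ 2 := sq_nonneg _
    have h2 : g ^ 2 * m ^ 2 ≤ g ^ 2 * 1 := by gcongr; nlinarith
    have h3 : g ^ 2 ≤ 1 / 64 := by nlinarith
    have h4 : h ^ 2 * g ^ 2 ≤ h ^ 2 * (1 / 64) := by gcongr
    nlinarith [sq_nonneg h, sq_nonneg (h + 4 * g * m), sq_nonneg g]
  nlinarith [key]

end PMF

/-! ### Change of measure within one episode. -/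

namespace FHMDP

variable {S : Type u} {A : Type v} {H : ℕ}

open Classical in
/-- The number of visits to the state-action pair `(i, a)` in an episode. -/
noncomputable def visits (i : S) (a : A) (x : Episode S A) : ℝ≥0∞ := (x.1.count (i, a) : ℝ≥0∞)

open Classical in
/-- The expected number of visits to `(i, a)` in the remaining `k` steps of an episode. -/
noncomputable def rolloutVisits (M : FHMDP S A H) (i : S) (a : A) (b : List (S × A) → S → PMF A) :
    ℕ → List (S × A) → S → ℝ≥0∞
  | 0, _, _ => 0
  | k + 1, e, s => (b e s).expect fun a' =>
      (if (s, a') = (i, a) then 1 else 0) +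
        (M.p s a').expect fun s' => rolloutVisits M i a b k (e ++ [(s, a')]) s'

theorem expect_visits_rollout (M : FHMDP S A H) (i : S) (a : A) (b : List (S × A) → S → PMF A)
    (k : ℕ) (e : List (S × A)) (s : S) :
    (M.rollout b k e s).expect (visits i a) = visits i a (e, s) + M.rolloutVisits i a b k e s := by
  classical
  induction k generalizing e s with
  | zero => simp [rollout, rolloutVisits, PMF.expect_pure]
  | succ k ih =>
    rw [rollout, rolloutVisits]
    simp only [PMF.expect_bind, ih]
    rw [← PMF.expect_const (b e s) (visits i a (e, s)), ← PMF.expect_add]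
    congr 1
    funext a'
    rw [PMF.expect_add, ← add_assoc]
    congr 1
    simp only [visits, PMF.expect_const]
    by_cases h : (s, a') = (i, a)
    · simp [h]
    · simp [h]

/-- Two MDPs that differ in a single transition law `p i a` by at most `c` have episode laws that
differ by at most `c` times the expected number of visits to `(i, a)`. -/
theorem close_rollout {M M' : FHMDP S A H} {i : S} {a : A} {c : ℝ≥0∞}
    (hc : (M.p i a).Close (M'.p i a) c) (heq : ∀ s a', (s, a') ≠ (i, a) → M.p s a' = M'.p s a')
    (b : List (S × A) → S → PMF A) (k : ℕ) (e : List (S × A)) (s : S) :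
    (M.rollout b k e s).Close (M'.rollout b k e s) (c * M.rolloutVisits i a b k e s) := by
  classical
  induction k generalizing e s with
  | zero => simpa [rollout, rolloutVisits] using PMF.Close.refl _
  | succ k ih =>
    rw [rollout, rollout, rolloutVisits, ← PMF.expect_mul_left,
      ← zero_add (PMF.expect _ _)]
    refine (PMF.Close.refl _).bind fun a' => ?_
    rw [mul_add, ← PMF.expect_mul_left]
    refine PMF.Close.bind ?_ fun s' => ih _ _
    by_cases h : (s, a') = (i, a)
    · obtain ⟨rfl, rfl⟩ := Prod.mk.inj h
      simpa using hc
    · rw [heq s a' h]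
      simpa [h] using PMF.Close.refl _

theorem close_episodeLaw {M M' : FHMDP S A H} {i : S} {a : A} {c : ℝ≥0∞} (h0 : M.p0 = M'.p0)
    (hc : (M.p i a).Close (M'.p i a) c) (heq : ∀ s a', (s, a') ≠ (i, a) → M.p s a' = M'.p s a')
    (b : List (S × A) → S → PMF A) :
    (M.episodeLaw b).Close (M'.episodeLaw b) (c * (M.episodeLaw b).expect (visits i a)) := by
  rw [episodeLaw, episodeLaw, ← h0, PMF.expect_bind, ← PMF.expect_mul_left,
    ← zero_add (PMF.expect _ _)]
  refine (PMF.Close.refl _).bind fun s => ?_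
  rw [expect_visits_rollout]
  simpa [visits] using close_rollout hc heq b H [] s

end FHMDP

/-! ### Change of measure for the whole interaction. -/

namespace Status

variable {S : Type u} {A : Type v} {H : ℕ}

/-- The total number of visits to `(i, a)` in the complete episodes. -/
noncomputable def visits (i : S) (a : A) (x : Status S A H) : ℝ≥0∞ :=
  (x.episodes.map (FHMDP.visits i a)).sum

instance instCountable [Finite S] [Finite A] : Countable (Status S A H) :=
  Function.Injective.countable (f := fun x : Status S A H => (x.episodes, x.output))
    fun x y h => by cases x; cases y; simpa using h

theorem measurableSet (s : Set (Status S A H)) : MeasurableSet s := trivial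

instance instMeasurableSingletonClass : MeasurableSingletonClass (Status S A H) := ⟨fun _ => trivial⟩

end Status

namespace Learner

variable {S : Type u} {A : Type v} {H : ℕ}

/-- The law of the status after `k` rounds. -/
noncomputable def statusLaw (L : Learner S A H) (M : FHMDP S A H) : ℕ → PMF (Status S A H)
  | 0 => PMF.pure ⟨[], none⟩
  | k + 1 => (statusLaw L M k).bind (L.round M)

/-- The expected number of visits to `(i, a)` in the next round. -/
noncomputable def roundVisits (L : Learner S A H) (M : FHMDP S A H) (i : S) (a : A) :
    Status S A H → ℝ≥0∞
  | ⟨_, some _⟩ => 0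
  | ⟨h, none⟩ => (L.decide h).expect fun d =>
      match d with
      | some _ => 0
      | none => (M.episodeLaw (L.act h)).expect (FHMDP.visits i a)

theorem expect_visits_round (L : Learner S A H) (M : FHMDP S A H) (i : S) (a : A)
    (x : Status S A H) :
    (L.round M x).expect (Status.visits i a) = x.visits i a + L.roundVisits M i a x := by
  obtain ⟨h, _ | π⟩ := x
  · rw [round, roundVisits, PMF.expect_bind,
      ← PMF.expect_const (L.decide h) (Status.visits i a ⟨h, none⟩), ← PMF.expect_add]
    congr 1
    funext d
    cases d with
    | none => simp [PMF.expect_map, Status.visits, PMF.expect_add, PMF.expect_const]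
    | some π => simp [PMF.expect_pure, Status.visits]
  · simp [round, roundVisits, PMF.expect_pure]

theorem close_round (L : Learner S A H) {M M' : FHMDP S A H} {i : S} {a : A} {c : ℝ≥0∞}
    (h0 : M.p0 = M'.p0) (hc : (M.p i a).Close (M'.p i a) c)
    (heq : ∀ s a', (s, a') ≠ (i, a) → M.p s a' = M'.p s a') (x : Status S A H) :
    (L.round M x).Close (L.round M' x) (c * L.roundVisits M i a x) := by
  obtain ⟨h, _ | π⟩ := x
  · rw [round, round, roundVisits, ← PMF.expect_mul_left, ← zero_add (PMF.expect _ _)]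
    refine (PMF.Close.refl _).bind fun d => ?_
    cases d with
    | none => exact (FHMDP.close_episodeLaw h0 hc heq _).map _
    | some π => simpa using PMF.Close.refl _
  · simpa [round, roundVisits] using PMF.Close.refl _

/-- The chain rule adds up the costs of the rounds, and expected visits add up in the same way.
Visits are counted under `M` only, so one reference instance can be compared with many alternatives.
-/
theorem close_statusLaw (L : Learner S A H) {M M' : FHMDP S A H} {i : S} {a : A} {c : ℝ≥0∞}
    (h0 : M.p0 = M'.p0) (hc : (M.p i a).Close (M'.p i a) c)
    (heq : ∀ s a', (s, a') ≠ (i, a) → M.p s a' = M'.p s a') (k : ℕ) :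
    (L.statusLaw M k).Close (L.statusLaw M' k)
      (c * (L.statusLaw M k).expect (Status.visits i a)) := by
  induction k with
  | zero => simpa [statusLaw, PMF.expect_pure, Status.visits] using PMF.Close.refl _
  | succ k ih =>
    rw [statusLaw, statusLaw, PMF.expect_bind]
    simp only [expect_visits_round]
    rw [PMF.expect_add, mul_add, ← PMF.expect_mul_left _ c (L.roundVisits M i a)]
    exact ih.bind fun x => L.close_round h0 hc heq x

/-! ### From the trajectory measure to finitely many rounds. -/

/-- Joint law of consecutive statuses. -/
theorem interactionLaw_inter (L : Learner S A H) (M : FHMDP S A H) (k : ℕ)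
    (s t : Set (Status S A H)) :
    L.interactionLaw M {ω | ω k ∈ s ∧ ω (k + 1) ∈ t} =
      ∫⁻ ω in {ω | ω k ∈ s}, (L.round M (ω k)).toMeasure t ∂(L.interactionLaw M) := by
  have hs : MeasurableSet s := trivial
  have ht : MeasurableSet t := trivial
  have hk : Measurable fun x : (Π _ : Finset.Iic k, Status S A H) =>
      x ⟨k, Finset.mem_Iic.2 le_rfl⟩ := measurable_pi_apply _
  have key := Kernel.partialTraj_compProd_eq_map_traj (X := fun _ => Status S A H)
    (κ := L.roundKernel M) (a := 0) (b := k) (Nat.zero_le k) (x₀ := fun _ => ⟨[], none⟩)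
  have h1 := congrArg (fun μ => μ (((fun x : (Π _ : Finset.Iic k, Status S A H) =>
      x ⟨k, Finset.mem_Iic.2 le_rfl⟩) ⁻¹' s) ×ˢ t)) key
  rw [Measure.compProd_apply_prod (hk hs) ht,
    Measure.map_apply (by fun_prop) ((hk hs).prod ht)] at h1
  have h2 := Kernel.traj_map_frestrictLe_apply (X := fun _ => Status S A H)
    (κ := L.roundKernel M) 0 k (fun _ => ⟨[], none⟩)
  rw [← h2, setLIntegral_map (hk hs) (Kernel.measurable_coe _ ht) (by fun_prop)] at h1
  exact h1.symm

theorem map_interactionLaw [Finite S] [Finite A] (L : Learner S A H) (M : FHMDP S A H) (k : ℕ) :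
    (L.interactionLaw M).map (fun ω => ω k) = (L.statusLaw M k).toMeasure := by
  induction k with
  | zero =>
    have h := Kernel.traj_map_frestrictLe_apply (X := fun _ => Status S A H)
      (κ := L.roundKernel M) 0 0 (fun _ => ⟨[], none⟩)
    rw [Kernel.partialTraj_self, Kernel.id_apply] at h
    have h' := congrArg (fun μ => μ.map fun x : (Π _ : Finset.Iic 0, Status S A H) =>
      x ⟨0, Finset.mem_Iic.2 le_rfl⟩) h
    beta_reduce at h'
    rw [Measure.map_map (by fun_prop) (by fun_prop),
      Measure.map_dirac' (measurable_pi_apply _)] at h'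
    rw [statusLaw, PMF.toMeasure_pure]
    exact h'
  | succ k ih =>
    ext t ht
    have h := L.interactionLaw_inter M k Set.univ t
    simp only [Set.mem_univ, true_and, Set.ofPred_true, Measure.restrict_univ] at h
    rw [Measure.map_apply (f := fun ω : ℕ → Status S A H => ω (k + 1)) (measurable_pi_apply _) ht]
    refine h.trans ?_
    rw [statusLaw, PMF.toMeasure_bind_apply _ _ _ ht,
      ← lintegral_map (f := fun x => (L.round M x).toMeasure t)
        (g := fun ω : ℕ → Status S A H => ω k) measurable_from_top (measurable_pi_apply _), ih,
      PMF.lintegral_toMeasure]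
    rfl

theorem expect_length_le_expNumEpisodes [Finite S] [Finite A] (L : Learner S A H)
    (M : FHMDP S A H) (k : ℕ) :
    ((L.statusLaw M k).expect fun x => (x.episodes.length : ℝ≥0∞)) ≤ L.expNumEpisodes M := by
  rw [← PMF.lintegral_toMeasure, ← map_interactionLaw,
    lintegral_map measurable_from_top (measurable_pi_apply _)]
  exact lintegral_mono fun ω => le_iSup (fun k => ((ω k).episodes.length : ℝ≥0∞)) k

/-- The statuses in which a policy from `B` has been output. -/
def outputIn (B : Set (DetPolicy S A H)) : Set (Status S A H) :=
  {x | ∃ π, x.output = some π ∧ π ∈ B}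

/-- Once a policy has been output, the status does not change. -/
theorem ae_outputIn_succ (L : Learner S A H) (M : FHMDP S A H) (B : Set (DetPolicy S A H))
    (k : ℕ) :
    ∀ᵐ ω ∂(L.interactionLaw M), ω k ∈ outputIn B → ω (k + 1) ∈ outputIn B := by
  have hz : ∀ ω ∈ {ω : ℕ → Status S A H | ω k ∈ outputIn B},
      (L.round M (ω k)).toMeasure (outputIn B)ᶜ = 0 := by
    rintro ω ⟨π, hπ, hB⟩
    obtain ⟨e, o, hω⟩ : ∃ e o, ω k = ⟨e, o⟩ := ⟨_, _, rfl⟩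
    rw [hω] at hπ
    obtain rfl : o = some π := hπ
    rw [hω, round, PMF.toMeasure_pure, Measure.dirac_apply' _ (Status.measurableSet _)]
    have hmem : (⟨e, some π⟩ : Status S A H) ∉ (outputIn B)ᶜ :=
      Set.notMem_compl_iff.2 ⟨π, rfl, hB⟩
    exact Set.indicator_of_notMem hmem _
  have h := (L.interactionLaw_inter M k (outputIn B) (outputIn B)ᶜ).trans
    (setLIntegral_eq_zero (measurable_pi_apply k (Status.measurableSet _)) hz)
  rw [ae_iff]
  simpa using h

/-- The events of having output a policy from `B` increase almost surely, so continuity from below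
turns the PAC guarantee, which has no time limit, into one at a finite round. -/
theorem exists_forall_lt_expect_outputIn [Finite S] [Finite A] (L : Learner S A H)
    (M : FHMDP S A H) (B : Set (DetPolicy S A H)) {r : ℝ≥0∞}
    (hr : r < L.interactionLaw M {ω | ∃ k π, (ω k).output = some π ∧ π ∈ B}) :
    ∃ K, ∀ k ≥ K, r < (L.statusLaw M k).expect ((outputIn B).indicator 1) := by
  have hU : {ω : ℕ → Status S A H | ∃ k π, (ω k).output = some π ∧ π ∈ B} =
      ⋃ k, {ω | ω k ∈ outputIn B} := by
    ext ω
    simp [outputIn]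
  have hmono : ∀ᵐ ω ∂(L.interactionLaw M), Monotone fun k => ω k ∈ outputIn B := by
    have := ae_all_iff.2 (L.ae_outputIn_succ M B)
    filter_upwards [this] with ω hω
    exact monotone_nat_of_le_succ hω
  rw [hU, measure_iUnion_eq_iSup_accumulate, lt_iSup_iff] at hr
  obtain ⟨K, hK⟩ := hr
  refine ⟨K, fun k hk => hK.trans_le ?_⟩
  rw [← PMF.toMeasure_eq_expect_indicator _ (Status.measurableSet _), ← map_interactionLaw,
    Measure.map_apply (f := fun ω : ℕ → Status S A H => ω k) (measurable_pi_apply _)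
      (Status.measurableSet _)]
  refine measure_mono_ae ?_
  filter_upwards [hmono] with ω hω hmem
  obtain ⟨j, hj, hj'⟩ := Set.mem_accumulate.1 hmem
  exact hω (hj.trans hk) hj'

end Learner

/-! ### The hard instances and their returns. -/

/-- A family of parallel bandits with three distinguished states and at least one bandit. An arm
has success probability `1 / 2`, or `1 / 2 + gap` if it is the distinguished arm of its bandit. -/
structure BanditFamily (S : Type u) where
  start : S
  good : S
  bad : S
  start_ne_good : start ≠ good
  start_ne_bad : start ≠ bad
  good_ne_bad : good ≠ bad
  gap : NNReal
  gap_le : gap ≤ 1 / 8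
  exists_bandit : ∃ i, i ≠ start ∧ i ≠ good ∧ i ≠ bad

namespace BanditFamily

variable {S : Type u} {A : Type v} {H : ℕ}

open Classical in
/-- The success probabilities: `θ i = (a, true)` distinguishes the arm `a` of bandit `i`, while
`θ i = (a, false)` distinguishes no arm. -/
noncomputable def success (F : BanditFamily S) (θ : S → A × Bool) (i : S) (a : A) : NNReal :=
  if θ i = (a, true) then 1 / 2 + F.gap else 1 / 2

theorem success_le_one (F : BanditFamily S) (θ : S → A × Bool) (i : S) (a : A) :
    F.success θ i a ≤ 1 := by
  have h := NNReal.coe_le_coe.2 F.gap_le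
  push_cast at h
  unfold success
  rw [← NNReal.coe_le_coe]
  split_ifs <;> push_cast <;> linarith

/-- The transition law of an arm. -/
noncomputable def pull (F : BanditFamily S) (θ : S → A × Bool) (i : S) (a : A) : PMF S :=
  (PMF.coin (F.success θ i a) (F.success_le_one θ i a)).map fun b => cond b F.good F.bad

theorem pull_good (F : BanditFamily S) (θ : S → A × Bool) (i : S) (a : A) :
    F.pull θ i a F.good = F.success θ i a := by
  rw [pull, PMF.map_apply, tsum_fintype, Fintype.sum_bool]
  simp [F.good_ne_bad, PMF.coin, PMF.ofFintype_apply]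

theorem pull_bad (F : BanditFamily S) (θ : S → A × Bool) (i : S) (a : A) :
    F.pull θ i a F.bad = ((1 - F.success θ i a : NNReal) : ℝ≥0∞) := by
  rw [pull, PMF.map_apply, tsum_fintype, Fintype.sum_bool]
  simp [F.good_ne_bad.symm, PMF.coin, PMF.ofFintype_apply]

variable [Fintype S]

/-- The bandit states. -/
abbrev Bandit (F : BanditFamily S) : Type u := {i : S // i ≠ F.start ∧ i ≠ F.good ∧ i ≠ F.bad}

noncomputable instance (F : BanditFamily S) : Fintype F.Bandit := Fintype.ofFinite _

instance (F : BanditFamily S) : Nonempty F.Bandit :=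
  let ⟨i, hi⟩ := F.exists_bandit
  ⟨⟨i, hi⟩⟩

theorem card_bandit (F : BanditFamily S) : Fintype.card F.Bandit + 3 = Fintype.card S := by
  classical
  have h : ({F.start, F.good, F.bad} : Finset S).card = 3 :=
    Finset.card_eq_three.2 ⟨_, _, _, F.start_ne_good, F.start_ne_bad, F.good_ne_bad, rfl⟩
  rw [← h, Fintype.card_subtype, ← Finset.card_add_card_compl ({F.start, F.good, F.bad} : Finset S),
    add_comm]
  congr 2
  ext i
  simp

open Classical in
/-- The parallel bandits as an episodic MDP. -/
noncomputable def mdp (F : BanditFamily S) (H : ℕ) (θ : S → A × Bool) : FHMDP S A H where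
  r _ s := if s = F.good then 1 else 0
  r_nonneg _ s := by split_ifs <;> norm_num
  r_le_one _ s := by split_ifs <;> norm_num
  p s a :=
    if s = F.start then (PMF.uniformOfFintype F.Bandit).map Subtype.val
    else if s = F.good then PMF.pure F.good
    else if s = F.bad then PMF.pure F.bad
    else F.pull θ s a
  p0 := PMF.pure F.start

variable (F : BanditFamily S) (θ : S → A × Bool)

theorem mdp_p_start (a : A) : (F.mdp H θ).p F.start a =
    (PMF.uniformOfFintype F.Bandit).map Subtype.val := by simp [mdp]

theorem mdp_p_good (a : A) : (F.mdp H θ).p F.good a = PMF.pure F.good := by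
  simp [mdp, F.start_ne_good.symm]

theorem mdp_p_bad (a : A) : (F.mdp H θ).p F.bad a = PMF.pure F.bad := by
  simp [mdp, F.start_ne_bad.symm, F.good_ne_bad.symm]

theorem mdp_p_bandit (i : F.Bandit) (a : A) : (F.mdp H θ).p i a = F.pull θ i a := by
  obtain ⟨i, h1, h2, h3⟩ := i
  simp [mdp, h1, h2, h3]

theorem card_bandit_real : (Fintype.card F.Bandit : ℝ) = (Fintype.card S : ℝ) - 3 := by
  have : (Fintype.card F.Bandit : ℝ) + 3 = Fintype.card S := by exact_mod_cast F.card_bandit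
  linarith

theorem uniform_map_val (i : F.Bandit) :
    ((PMF.uniformOfFintype F.Bandit).map Subtype.val) (i : S) = (Fintype.card F.Bandit : ℝ≥0∞)⁻¹ := by
  classical
  rw [PMF.map_apply, tsum_eq_single i]
  · simp
  · intro j hj
    rw [if_neg fun h => hj (Subtype.ext h.symm)]

theorem isParallelBandits_mdp : (F.mdp H θ).IsParallelBandits := by
  refine ⟨F.start, F.good, F.bad, F.start_ne_good, F.start_ne_bad, F.good_ne_bad, rfl, ?_, ?_, ?_,
    ?_, F.mdp_p_good θ, F.mdp_p_bad θ⟩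
  · simp [mdp]
  · intro t s hs
    simp [mdp, hs]
  · intro a i h1 h2 h3
    rw [mdp_p_start, F.uniform_map_val ⟨i, h1, h2, h3⟩, ← F.card_bandit_real]
    simp
  · intro i a h1 h2 h3
    rw [F.mdp_p_bandit θ ⟨i, h1, h2, h3⟩, pull_good, pull_bad]
    exact_mod_cast add_tsub_cancel_of_le (F.success_le_one θ i a)

theorem pull_bind_mdp (i : S) (a : A) (f : S → A) :
    ((F.pull θ i a).bind fun s => (F.mdp H θ).p s (f s)) = F.pull θ i a := by
  rw [pull, PMF.bind_map, PMF.map]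
  congr 1
  funext b
  cases b
  · exact F.mdp_p_bad θ _
  · exact F.mdp_p_good θ _

/-- After the pull the state is absorbing, so the law is frozen from time `2` on and only the action
at time `1` matters. -/
theorem stateLaw_mdp (π : DetPolicy S A H) (t : ℕ) (h : t + 2 < H) :
    (F.mdp H θ).stateLaw π (t + 2) h =
      (PMF.uniformOfFintype F.Bandit).bind fun i => F.pull θ i (π ⟨1, by omega⟩ i) := by
  induction t with
  | zero =>
    rw [FHMDP.stateLaw, FHMDP.stateLaw, FHMDP.stateLaw]
    rw [show (F.mdp H θ).p0 = PMF.pure F.start from rfl, PMF.pure_bind, mdp_p_start, PMF.bind_map]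
    congr 1
    funext i
    exact F.mdp_p_bandit θ i _
  | succ t ih =>
    rw [FHMDP.stateLaw, ih, PMF.bind_bind]
    simp only [pull_bind_mdp]

theorem expReturn_mdp (π : DetPolicy S A H) (h1 : 1 < H) :
    (F.mdp H θ).expReturn π = ((H : ℝ) - 2) / Fintype.card F.Bandit *
      ∑ i : F.Bandit, (F.success θ i (π ⟨1, h1⟩ i) : ℝ) := by
  obtain ⟨K, rfl⟩ : ∃ K, H = K + 2 := ⟨H - 2, by omega⟩
  have hr : ∀ t : Fin (K + 2), ∑ s : S, ((F.mdp (K + 2) θ).stateLaw π t t.isLt s).toReal *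
      (F.mdp (K + 2) θ).r t s = ((F.mdp (K + 2) θ).stateLaw π t t.isLt F.good).toReal := by
    classical
    intro t
    have : ∀ s, (F.mdp (K + 2) θ).r t s = if s = F.good then 1 else 0 := fun s => by simp [mdp]
    simp only [this]
    simp
  have hs : ∀ t : Fin K, ((F.mdp (K + 2) θ).stateLaw π (t + 2) (by omega) F.good).toReal =
      (Fintype.card F.Bandit : ℝ)⁻¹ * ∑ i : F.Bandit, (F.success θ i (π ⟨1, h1⟩ i) : ℝ) := by
    intro t
    rw [stateLaw_mdp, PMF.bind_apply, tsum_fintype, ENNReal.toReal_sum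
      (fun i _ => ENNReal.mul_ne_top (PMF.apply_ne_top _ _) (PMF.apply_ne_top _ _)), Finset.mul_sum]
    refine Finset.sum_congr rfl fun i _ => ?_
    rw [pull_good, ENNReal.toReal_mul]
    simp
  -- The good state cannot be occupied at times `0` and `1`; this leaves the `H - 2` rewarded steps.
  have h_zero : (F.mdp (K + 2) θ).stateLaw π 0 (by omega) F.good = 0 := by
    simp [FHMDP.stateLaw, mdp, F.start_ne_good.symm]
  have h_one : (F.mdp (K + 2) θ).stateLaw π 1 (by omega) F.good = 0 := by
    rw [FHMDP.stateLaw, FHMDP.stateLaw, show (F.mdp (K + 2) θ).p0 = PMF.pure F.start from rfl,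
      PMF.pure_bind, mdp_p_start, PMF.map_apply]
    refine ENNReal.tsum_eq_zero.2 fun i => if_neg ?_
    exact i.2.2.1.symm
  unfold FHMDP.expReturn
  simp only [hr]
  rw [Fin.sum_univ_succ, Fin.sum_univ_succ]
  have e0 : ((F.mdp (K + 2) θ).stateLaw π ((0 : Fin (K + 2)) : ℕ) (0 : Fin (K + 2)).isLt F.good) = 0 :=
    h_zero
  have e1 : ((F.mdp (K + 2) θ).stateLaw π ((Fin.succ (0 : Fin (K + 1)) : Fin (K + 2)) : ℕ)
    (Fin.succ (0 : Fin (K + 1))).isLt F.good) = 0 := h_one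
  rw [e0, e1]
  have e2 : ∀ t : Fin K, ((F.mdp (K + 2) θ).stateLaw π (t.succ.succ : Fin (K + 2))
    t.succ.succ.isLt F.good).toReal = (Fintype.card F.Bandit : ℝ)⁻¹ *
      ∑ i : F.Bandit, (F.success θ i (π ⟨1, h1⟩ i) : ℝ) := hs
  simp only [e2]
  simp
  ring

open Classical in
/-- The bandits whose distinguished arm `π` misses. -/
noncomputable def missed (h1 : 1 < H) (π : DetPolicy S A H) : Finset F.Bandit :=
  Finset.univ.filter fun i => (θ i).2 = true ∧ π ⟨1, h1⟩ i ≠ (θ i).1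

theorem card_missed_le [Finite A] (h1 : 1 < H) {ε : ℝ} {π : DetPolicy S A H}
    (h : (F.mdp H θ).IsEpsOptimal ε π) :
    ((H : ℝ) - 2) * F.gap * (F.missed θ h1 π).card ≤ ε * Fintype.card F.Bandit := by
  classical
  -- The comparison policy pulls every hidden arm; in a bandit without one, all arms are equally
  -- good.
  set πs : DetPolicy S A H := fun _ i => (θ i).1
  have hn : (0 : ℝ) < Fintype.card F.Bandit := by exact_mod_cast Fintype.card_pos
  have hopt : (F.mdp H θ).expReturn πs ≤ (F.mdp H θ).optReturn :=
    le_ciSup (f := (F.mdp H θ).expReturn) (Set.finite_range _).bddAbove πs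
  have hdiff : ∀ i : F.Bandit, (F.success θ i (πs ⟨1, h1⟩ i) : ℝ) -
      F.success θ i (π ⟨1, h1⟩ i) = if i ∈ F.missed θ h1 π then (F.gap : ℝ) else 0 := by
    intro i
    obtain ⟨a, b, hab⟩ : ∃ a b, θ i = (a, b) := ⟨_, _, rfl⟩
    cases b
    · simp [success, missed, πs, hab]
    · by_cases hπ : π ⟨1, h1⟩ i = a
      · simp [success, missed, πs, hab, hπ]
      · simp [success, missed, πs, hab, hπ, Ne.symm hπ]
  have hsum : ∑ i : F.Bandit, (F.success θ i (πs ⟨1, h1⟩ i) : ℝ) -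
      ∑ i : F.Bandit, (F.success θ i (π ⟨1, h1⟩ i) : ℝ) = F.gap * (F.missed θ h1 π).card := by
    rw [← Finset.sum_sub_distrib]
    simp only [hdiff]
    rw [Finset.sum_ite_mem]
    simp [mul_comm]
  have h' : (F.mdp H θ).expReturn πs - (F.mdp H θ).expReturn π ≤ ε := by
    unfold FHMDP.IsEpsOptimal at h
    linarith
  rw [expReturn_mdp _ _ _ h1, expReturn_mdp _ _ _ h1, ← mul_sub, hsum, div_mul_eq_mul_div,
    div_le_iff₀ hn] at h'
  linarith

/-- The arm is an inert label when the flag is `false`. Thus a single reference instance can be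
paired with the alternative for every arm. -/
theorem mdp_update_false [DecidableEq S] (i : S) (a a' : A) :
    F.mdp H (Function.update θ i (a, false)) = F.mdp H (Function.update θ i (a', false)) := by
  have : ∀ s b, F.pull (Function.update θ i (a, false)) s b =
      F.pull (Function.update θ i (a', false)) s b := by
    intro s b
    have : F.success (Function.update θ i (a, false)) s b =
        F.success (Function.update θ i (a', false)) s b := by
      by_cases hs : s = i
      · subst hs
        simp [success]
      · rw [success, success, Function.update_of_ne hs, Function.update_of_ne hs]
    simp only [pull, this]
  unfold mdp
  congr 1
  funext s b
  rw [this]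

theorem mdp_p_congr {θ θ' : S → A × Bool} {s : S} {a : A} (h : F.success θ s a = F.success θ' s a) :
    (F.mdp H θ).p s a = (F.mdp H θ').p s a := by
  simp only [mdp, pull, h]

theorem mdp_p_update [DecidableEq S] (i : S) (a : A) (s : S) (b : A) (h : (s, b) ≠ (i, a)) :
    (F.mdp H (Function.update θ i (a, false))).p s b =
      (F.mdp H (Function.update θ i (a, true))).p s b := by
  apply mdp_p_congr
  by_cases hs : s = i
  · subst hs
    have : a ≠ b := fun hab => h (by rw [hab])
    simp [success, this]
  · rw [success, success, Function.update_of_ne hs, Function.update_of_ne hs]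

theorem close_mdp_p_update [DecidableEq S] (i : F.Bandit) (a : A) :
    ((F.mdp H (Function.update θ i (a, false))).p i a).Close
      ((F.mdp H (Function.update θ i (a, true))).p i a) (ENNReal.ofReal (5 * F.gap ^ 2)) := by
  rw [mdp_p_bandit, mdp_p_bandit]
  have h := NNReal.coe_le_coe.2 F.gap_le
  push_cast at h
  exact (PMF.close_coin_half F.gap.coe_nonneg h _ _ (by simp [success]) (by simp [success])).map _

end BanditFamily

/-- Averaging over one coordinate does not change a sum over all functions. -/
theorem sum_sum_update {ι X R : Type*} [Fintype ι] [DecidableEq ι] [Fintype X] [CommSemiring R]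
    (i : ι) (f : (ι → X) → R) :
    ∑ θ, ∑ x, f (Function.update θ i x) = Fintype.card X * ∑ θ, f θ := by
  have e : ∑ q : (ι → X) × X, f (Function.update q.1 i q.2) = ∑ q : (ι → X) × X, f q.1 := by
    -- Swapping the `i`-th coordinate with the extra variable is an involution.
    refine Finset.sum_bij' (fun q _ => (Function.update q.1 i q.2, q.1 i))
      (fun q _ => (Function.update q.1 i q.2, q.1 i)) ?_ ?_ ?_ ?_ ?_ <;> simp
  rw [← Fintype.sum_prod_type' (f := fun θ x => f (Function.update θ i x)), e,
    Fintype.sum_prod_type' (f := fun θ _ => f θ)]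
  simp [Finset.mul_sum]

/-! ### Missed arms. -/

namespace BanditFamily

variable {S : Type u} {A : Type v} {H : ℕ} [Fintype S]

/-- The probability that `L` has not output a policy that pulls `a` in bandit `i` after `N`
episodes. -/
noncomputable def missProb (F : BanditFamily S) (L : Learner S A H) (N : ℕ) (h1 : 1 < H)
    (θ : S → A × Bool) (i : S) (a : A) : ℝ≥0∞ :=
  (L.statusLaw (F.mdp H θ) N).expect
    ((Learner.outputIn {π : DetPolicy S A H | π ⟨1, h1⟩ i = a})ᶜ.indicator 1)

/-- The probability that `L` misses the distinguished arm of bandit `i`. -/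
noncomputable def missArm (F : BanditFamily S) (L : Learner S A H) (N : ℕ) (h1 : 1 < H)
    (θ : S → A × Bool) (i : S) : ℝ≥0∞ :=
  if (θ i).2 = true then F.missProb L N h1 θ i (θ i).1 else 0

theorem sum_missArm_le (F : BanditFamily S) (L : Learner S A H) (N : ℕ) (h1 : 1 < H)
    (θ : S → A × Bool) (B : Set (DetPolicy S A H)) {c : ℝ≥0∞}
    (hB : ∀ π ∈ B, ((F.missed θ h1 π).card : ℝ≥0∞) ≤ c) :
    ∑ i : F.Bandit, F.missArm L N h1 θ i ≤ c + Fintype.card F.Bandit *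
      (L.statusLaw (F.mdp H θ) N).expect ((Learner.outputIn B)ᶜ.indicator 1) := by
  classical
  have h : ∀ i : F.Bandit, F.missArm L N h1 θ i = (L.statusLaw (F.mdp H θ) N).expect fun x =>
      if (θ i).2 = true then
        (Learner.outputIn {π : DetPolicy S A H | π ⟨1, h1⟩ i = (θ i).1})ᶜ.indicator 1 x
      else 0 := by
    intro i
    unfold missArm
    split_ifs
    · rfl
    · rw [PMF.expect_const]
  simp only [h]
  rw [← PMF.expect_finset_sum, ← PMF.expect_mul_left,
    ← PMF.expect_const (L.statusLaw (F.mdp H θ) N) c, ← PMF.expect_add]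
  refine PMF.expect_mono _ fun x => ?_
  by_cases hx : x ∈ Learner.outputIn B
  · obtain ⟨π, hπ, hπB⟩ := hx
    refine le_add_right (le_trans ?_ (hB π hπB))
    rw [missed, Finset.card_filter, Nat.cast_sum]
    refine Finset.sum_le_sum fun i _ => ?_
    by_cases hi : (θ i).2 = true
    · by_cases hp : π ⟨1, h1⟩ i = (θ i).1
      · have : x ∉ (Learner.outputIn {π : DetPolicy S A H | π ⟨1, h1⟩ i = (θ i).1})ᶜ :=
          Set.notMem_compl_iff.2 ⟨π, hπ, hp⟩
        rw [Set.indicator_of_notMem this]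
        simp
      · simp only [hi, hp, if_true, ne_eq, not_false_eq_true, and_self, Nat.cast_one]
        exact Set.indicator_le_self' (by simp) _
    · simp [hi]
  -- If no policy from `B` has been output, every bandit may count as missed.
  · refine le_add_left ?_
    rw [Set.indicator_of_mem (s := (Learner.outputIn B)ᶜ) hx]
    calc _ ≤ ∑ i : F.Bandit, (1 : ℝ≥0∞) := by
          refine Finset.sum_le_sum fun i _ => ?_
          split_ifs
          · exact Set.indicator_le_self' (by simp) _
          · exact zero_le
      _ = _ := by simp

/-! ### At most one pull per episode. -/

variable [Fintype A]

/-- The number of pulls in an episode. -/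
noncomputable def pulls (F : BanditFamily S) (x : Episode S A) : ℝ≥0∞ :=
  ∑ i : F.Bandit, ∑ a : A, FHMDP.visits (i : S) a x

open Classical in
/-- The number of pulls that are possible in the rest of an episode when the state is `s`. -/
noncomputable def remaining (F : BanditFamily S) (s : S) : ℝ≥0∞ :=
  if s = F.good ∨ s = F.bad then 0 else 1

theorem pulls_append (F : BanditFamily S) (e : List (S × A)) (s s' s'' : S) (a : A) :
    F.pulls (e ++ [(s, a)], s') = F.pulls (e, s'') + F.pulls ([(s, a)], s') := by
  simp [pulls, FHMDP.visits, Finset.sum_add_distrib]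

theorem pulls_singleton_eq_zero (F : BanditFamily S) {s : S} (s' : S) (a : A)
    (hs : s = F.start ∨ s = F.good ∨ s = F.bad) : F.pulls ([(s, a)], s') = 0 := by
  classical
  unfold pulls FHMDP.visits
  refine Finset.sum_eq_zero fun i _ => Finset.sum_eq_zero fun b _ => ?_
  have : (s, a) ≠ ((i : S), b) := by
    rintro h
    obtain ⟨rfl, -⟩ := Prod.mk.inj h
    have := i.2
    tauto
  exact_mod_cast List.count_eq_zero.2 (by rw [List.mem_singleton]; exact this.symm)

theorem pulls_singleton_le_one (F : BanditFamily S) (s s' : S) (a : A) :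
    F.pulls ([(s, a)], s') ≤ 1 := by
  classical
  unfold pulls FHMDP.visits
  rw [← Fintype.sum_prod_type' (f := fun (i : F.Bandit) (b : A) =>
    ((List.count ((i : S), b) [(s, a)] : ℕ) : ℝ≥0∞))]
  have : ∀ q : F.Bandit × A, ((List.count ((q.1 : S), q.2) [(s, a)] : ℕ) : ℝ≥0∞) =
      if ((q.1 : S), q.2) = (s, a) then 1 else 0 := by
    intro q
    by_cases h : ((q.1 : S), q.2) = (s, a)
    · simp [h]
    · simp [h, Ne.symm h]
  simp only [this]
  rw [Finset.sum_boole]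
  have : (Finset.univ.filter fun q : F.Bandit × A => ((q.1 : S), q.2) = (s, a)).card ≤ 1 := by
    refine Finset.card_le_one.2 fun q hq q' hq' => ?_
    have h := (Finset.mem_filter.1 hq).2.trans (Finset.mem_filter.1 hq').2.symm
    obtain ⟨h1, h2⟩ := Prod.mk.inj h
    exact Prod.ext (Subtype.ext h1) h2
  exact_mod_cast this

/-- `remaining` is a potential: a pull leads to an absorbing state and so uses up the single unit
available. -/
theorem pulls_add_remaining_le (F : BanditFamily S) (θ : S → A × Bool) (s s' : S) (a : A)
    (hs' : s' ∈ ((F.mdp H θ).p s a).support) :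
    F.pulls ([(s, a)], s') + F.remaining s' ≤ F.remaining s := by
  by_cases h1 : s = F.start
  · subst h1
    rw [F.pulls_singleton_eq_zero _ _ (Or.inl rfl), zero_add, remaining, remaining,
      if_neg (c := F.start = F.good ∨ _) (by simp [F.start_ne_good, F.start_ne_bad])]
    split_ifs <;> simp
  by_cases h2 : s = F.good
  · subst h2
    rw [mdp_p_good, PMF.support_pure] at hs'
    obtain rfl : s' = F.good := hs'
    rw [F.pulls_singleton_eq_zero _ _ (by simp), zero_add]
  by_cases h3 : s = F.bad
  · subst h3
    rw [mdp_p_bad, PMF.support_pure] at hs'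
    obtain rfl : s' = F.bad := hs'
    rw [F.pulls_singleton_eq_zero _ _ (by simp), zero_add]
  rw [F.mdp_p_bandit θ ⟨s, h1, h2, h3⟩, pull, PMF.support_map] at hs'
  obtain ⟨b, -, rfl⟩ := hs'
  have : F.remaining (cond b F.good F.bad) = 0 := by cases b <;> simp [remaining]
  rw [this, add_zero, remaining, if_neg (by tauto)]
  exact F.pulls_singleton_le_one _ _ _

theorem pulls_rollout_le (F : BanditFamily S) (θ : S → A × Bool) (b : List (S × A) → S → PMF A)
    (k : ℕ) (e : List (S × A)) (s : S) (x : Episode S A)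
    (hx : x ∈ ((F.mdp H θ).rollout b k e s).support) :
    F.pulls x ≤ F.pulls (e, s) + F.remaining s := by
  induction k generalizing e s with
  | zero =>
    rw [FHMDP.rollout, PMF.support_pure] at hx
    obtain rfl : x = (e, s) := hx
    exact le_self_add
  | succ k ih =>
    rw [FHMDP.rollout] at hx
    obtain ⟨a, -, hx⟩ := (PMF.mem_support_bind_iff _ _ _).1 hx
    obtain ⟨s', hs', hx⟩ := (PMF.mem_support_bind_iff _ _ _).1 hx
    refine (ih _ _ hx).trans ?_
    rw [F.pulls_append e s s' s a, add_assoc]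
    gcongr
    exact F.pulls_add_remaining_le θ s s' a hs'

theorem pulls_episodeLaw_le (F : BanditFamily S) (θ : S → A × Bool)
    (b : List (S × A) → S → PMF A) (x : Episode S A)
    (hx : x ∈ ((F.mdp H θ).episodeLaw b).support) : F.pulls x ≤ 1 := by
  obtain ⟨s, -, hx⟩ := (PMF.mem_support_bind_iff _ _ _).1 hx
  refine (F.pulls_rollout_le θ b H [] s x hx).trans ?_
  have h0 : F.pulls (([] : List (S × A)), s) = 0 := by simp [pulls, FHMDP.visits]
  rw [h0, zero_add, remaining]
  split_ifs <;> simp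

theorem sum_visits_le_length (F : BanditFamily S) (θ : S → A × Bool) (L : Learner S A H) (k : ℕ)
    (x : Status S A H) (hx : x ∈ (L.statusLaw (F.mdp H θ) k).support) :
    ∑ i : F.Bandit, ∑ a : A, x.visits (i : S) a ≤ x.episodes.length := by
  induction k generalizing x with
  | zero =>
    rw [Learner.statusLaw, PMF.support_pure] at hx
    obtain rfl : x = ⟨[], none⟩ := hx
    simp [Status.visits]
  | succ k ih =>
    obtain ⟨⟨e, o⟩, hy, hx⟩ := (PMF.mem_support_bind_iff _ _ _).1 hx
    have ih := ih _ hy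
    cases o with
    | some π =>
      rw [Learner.round, PMF.support_pure] at hx
      obtain rfl : x = ⟨e, some π⟩ := hx
      exact ih
    | none =>
      obtain ⟨d, -, hx⟩ := (PMF.mem_support_bind_iff _ _ _).1 hx
      cases d with
      | some π =>
        obtain rfl : x = ⟨e, some π⟩ := by simpa using hx
        exact ih
      | none =>
        obtain ⟨y, hy, rfl⟩ := (PMF.mem_support_map_iff _ _ _).1 hx
        have h1 := F.pulls_episodeLaw_le θ _ y hy
        simp only [Status.visits, List.map_append, List.sum_append, List.map_cons, List.map_nil,
          List.sum_cons, List.sum_nil, add_zero, Finset.sum_add_distrib, List.length_append,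
          List.length_cons, List.length_nil, Nat.cast_add] at ih ⊢
        refine add_le_add ih ?_
        simpa [pulls] using h1

/-! ### Trade-off between missed arms and pulls. -/

/-- An output policy pulls one arm in bandit `i` and misses the others; a learner that has not
stopped misses all of them. -/
theorem card_le_missProb (F : BanditFamily S) (L : Learner S A H) (N : ℕ) (h1 : 1 < H)
    (θ : S → A × Bool) (i : S) :
    (Fintype.card A : ℝ≥0∞) ≤ 1 + ∑ a : A, F.missProb L N h1 θ i a := by
  classical
  simp only [missProb]
  rw [← PMF.expect_finset_sum, ← PMF.expect_const (L.statusLaw (F.mdp H θ) N) 1,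
    ← PMF.expect_add, ← PMF.expect_const (L.statusLaw (F.mdp H θ) N) (Fintype.card A : ℝ≥0∞)]
  refine PMF.expect_mono _ fun x => ?_
  have hpt : ∀ a : A, (if x.output.map (fun π => π ⟨1, h1⟩ i) = some a then (0 : ℝ≥0∞) else 1) ≤
      (Learner.outputIn {π : DetPolicy S A H | π ⟨1, h1⟩ i = a})ᶜ.indicator 1 x := by
    intro a
    split_ifs with h
    · exact zero_le
    · rw [Set.indicator_of_mem]
      · rfl
      · rintro ⟨π, hπ, hπa⟩
        exact h (by simpa [hπ] using hπa)
  refine le_trans ?_ (add_le_add_right (Finset.sum_le_sum fun a _ => hpt a) 1)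
  cases x.output.map (fun π => π ⟨1, h1⟩ i) with
  | none => simp
  | some b =>
    have : ∀ a : A, (1 : ℝ≥0∞) = (if some b = some a then (0 : ℝ≥0∞) else 1) +
        if b = a then 1 else 0 := by
      intro a
      by_cases h : b = a <;> simp [h]
    calc (Fintype.card A : ℝ≥0∞) = ∑ a : A, (1 : ℝ≥0∞) := by simp
      _ = ∑ a : A, ((if some b = some a then (0 : ℝ≥0∞) else 1) + if b = a then 1 else 0) :=
          Finset.sum_congr rfl fun a _ => this a
      _ ≤ _ := by rw [Finset.sum_add_distrib, add_comm]; simp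

/-- The expected number of pulls in bandit `i` in the first `N` episodes. -/
noncomputable def expPulls (F : BanditFamily S) (L : Learner S A H) (N : ℕ)
    (θ : S → A × Bool) (i : S) : ℝ≥0∞ :=
  ∑ a : A, (L.statusLaw (F.mdp H θ) N).expect (Status.visits i a)

theorem sum_expPulls_le (F : BanditFamily S) (L : Learner S A H) (N : ℕ) (θ : S → A × Bool) :
    ∑ i : F.Bandit, F.expPulls L N θ i ≤
      (L.statusLaw (F.mdp H θ) N).expect fun x => (x.episodes.length : ℝ≥0∞) := by
  simp only [expPulls, ← PMF.expect_finset_sum]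
  exact PMF.expect_mono_support _ fun x hx => F.sum_visits_le_length θ L N x hx

theorem card_le_add [DecidableEq S] (F : BanditFamily S) (L : Learner S A H) (N : ℕ) (h1 : 1 < H)
    (θ : S → A × Bool) (i : F.Bandit) (a₀ : A) :
    (Fintype.card A : ℝ≥0∞) ≤
      1 + 2 * ∑ a : A, F.missProb L N h1 (Function.update θ i (a, true)) i a +
        ENNReal.ofReal (5 * F.gap ^ 2) * F.expPulls L N (Function.update θ i (a₀, false)) i := by
  refine (F.card_le_missProb L N h1 (Function.update θ i (a₀, false)) i).trans ?_
  rw [add_assoc]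
  gcongr
  rw [expPulls, Finset.mul_sum, Finset.mul_sum, ← Finset.sum_add_distrib]
  refine Finset.sum_le_sum fun a _ => ?_
  -- The reference instance is relabelled by `a`, so that it differs from the alternative only in
  -- the transition law of arm `a`.
  rw [missProb, F.mdp_update_false θ i a₀ a]
  have hclose := L.close_statusLaw (M := F.mdp H (Function.update θ (i : S) (a, false)))
    (M' := F.mdp H (Function.update θ (i : S) (a, true))) rfl (F.close_mdp_p_update θ i a)
    (fun s b h => F.mdp_p_update θ i a s b h) N
  exact hclose.prob_le _

/-- Summing `card_le_add` over the inert label gives reference and alternatives equal weight. Both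
sums then extend to all values of `θ i`: `missArm` vanishes when no arm is hidden, and further pulls
only weaken the bound. -/
theorem card_mul_card_le [DecidableEq S] (F : BanditFamily S) (L : Learner S A H) (N : ℕ)
    (h1 : 1 < H) (θ : S → A × Bool) (i : F.Bandit) :
    (Fintype.card A : ℝ≥0∞) * Fintype.card A ≤
      Fintype.card A + 2 * Fintype.card A * ∑ x, F.missArm L N h1 (Function.update θ i x) i +
        ENNReal.ofReal (5 * F.gap ^ 2) * ∑ x, F.expPulls L N (Function.update θ i x) i := by
  have h := Finset.sum_le_sum fun (a₀ : A) (_ : a₀ ∈ Finset.univ) => F.card_le_add L N h1 θ i a₀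
  simp only [Finset.sum_add_distrib, Finset.sum_const, Finset.card_univ, nsmul_eq_mul, mul_one,
    ← Finset.mul_sum] at h
  refine h.trans ?_
  rw [← mul_assoc, mul_comm (Fintype.card A : ℝ≥0∞) 2]
  gcongr
  · rw [Fintype.sum_prod_type]
    refine Finset.sum_le_sum fun a _ => ?_
    rw [Fintype.sum_bool]
    simp [missArm]
  · rw [Fintype.sum_prod_type]
    refine Finset.sum_le_sum fun a _ => ?_
    rw [Fintype.sum_bool]
    exact le_add_self

theorem sum_card_mul_card_le [DecidableEq S] (F : BanditFamily S) (L : Learner S A H) (N : ℕ)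
    (h1 : 1 < H) (i : F.Bandit) :
    (Fintype.card (S → A × Bool) : ℝ≥0∞) * (Fintype.card A * Fintype.card A) ≤
      Fintype.card (S → A × Bool) * Fintype.card A + 2 * Fintype.card A *
        (Fintype.card (A × Bool) * ∑ θ, F.missArm L N h1 θ i) +
        ENNReal.ofReal (5 * F.gap ^ 2) * (Fintype.card (A × Bool) * ∑ θ, F.expPulls L N θ i) := by
  have h := Finset.sum_le_sum fun (θ : S → A × Bool) (_ : θ ∈ Finset.univ) =>
    F.card_mul_card_le L N h1 θ i
  simp only [Finset.sum_add_distrib, ← Finset.mul_sum] at h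
  rw [sum_sum_update (i : S) (fun θ => F.missArm L N h1 θ i),
    sum_sum_update (i : S) (fun θ => F.expPulls L N θ i)] at h
  simpa only [Finset.sum_const, Finset.card_univ, nsmul_eq_mul,
    mul_left_comm (Fintype.card A : ℝ≥0∞) (Fintype.card (S → A × Bool) : ℝ≥0∞)] using h

end BanditFamily

/-! ### The lower bound for some configuration. -/

namespace BanditFamily

variable {S : Type u} {A : Type v} {H : ℕ} [Fintype S] [Fintype A]

theorem exists_le_expNumEpisodes [Nonempty A] (F : BanditFamily S) (L : Learner S A H) (h1 : 1 < H)
    (hgap : 0 < F.gap) (hA : 2 ≤ Fintype.card A) (B : (S → A × Bool) → Set (DetPolicy S A H))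
    (hB : ∀ θ, ∀ π ∈ B θ, 16 * (F.missed θ h1 π).card ≤ Fintype.card F.Bandit) {δ : ℝ}
    (hδ : δ < 1 / 240)
    (hP : ∀ θ, ENNReal.ofReal (1 - δ) ≤
      L.interactionLaw (F.mdp H θ) {ω | ∃ k π, (ω k).output = some π ∧ π ∈ B θ}) :
    ∃ θ, ENNReal.ofReal
      (Fintype.card F.Bandit * ((Fintype.card A : ℝ) - 1) / (40 * (F.gap : ℝ) ^ 2)) ≤
        L.expNumEpisodes (F.mdp H θ) := by
  classical
  by_contra! hcon
  have hex : ∀ θ, ∃ K, ∀ k ≥ K, ENNReal.ofReal (1 - 1 / 240) <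
      (L.statusLaw (F.mdp H θ) k).expect ((Learner.outputIn (B θ)).indicator 1) := fun θ =>
    -- The strict inequality `δ < 1 / 240` leaves room to stop at a finite round.
    L.exists_forall_lt_expect_outputIn _ _
      (((ENNReal.ofReal_lt_ofReal_iff (by linarith)).2 (by linarith)).trans_le (hP θ))
  choose K hK using hex
  -- A common round for the finitely many configurations.
  set N := ∑ θ, K θ
  have hN : ∀ θ, K θ ≤ N := fun θ => Finset.single_le_sum (fun _ _ => Nat.zero_le _)
    (Finset.mem_univ θ)
  have hcompl : ∀ θ, (L.statusLaw (F.mdp H θ) N).expect ((Learner.outputIn (B θ))ᶜ.indicator 1) ≤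
      ENNReal.ofReal (1 / 240) := by
    intro θ
    have hsum : (L.statusLaw (F.mdp H θ) N).expect ((Learner.outputIn (B θ)).indicator 1) +
        (L.statusLaw (F.mdp H θ) N).expect ((Learner.outputIn (B θ))ᶜ.indicator 1) = 1 := by
      rw [← PMF.expect_add, ← PMF.expect_const (L.statusLaw (F.mdp H θ) N) 1]
      congr 1
      funext x
      exact Set.indicator_self_add_compl_apply (Learner.outputIn (B θ)) 1 x
    have hlt := hK θ N (hN θ)
    have hfin : ENNReal.ofReal (1 - 1 / 240) ≠ ⊤ := ENNReal.ofReal_ne_top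
    refine (ENNReal.add_le_add_iff_left hfin).1 ?_
    rw [← ENNReal.ofReal_add (by norm_num) (by norm_num)]
    norm_num at hlt hsum ⊢
    exact (add_le_add_left hlt.le _).trans hsum.le
  set n : ℝ := (Fintype.card F.Bandit : ℝ)
  set m : ℝ := (Fintype.card A : ℝ)
  set T : ℝ := (Fintype.card (S → A × Bool) : ℝ)
  set b : ℝ := n * (m - 1) / (40 * (F.gap : ℝ) ^ 2)
  have hn : 0 < n := Nat.cast_pos.2 Fintype.card_pos
  have hm : 2 ≤ m := Nat.ofNat_le_cast.2 hA
  have hT : 0 < T := Nat.cast_pos.2 Fintype.card_pos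
  have hg : (0 : ℝ) < F.gap := hgap
  have hb : 0 ≤ b := div_nonneg (mul_nonneg hn.le (by linarith)) (by positivity)
  have cn : (Fintype.card F.Bandit : ℝ≥0∞) = ENNReal.ofReal n := (ENNReal.ofReal_natCast _).symm
  have cm : (Fintype.card A : ℝ≥0∞) = ENNReal.ofReal m := (ENNReal.ofReal_natCast _).symm
  have cT : (Fintype.card (S → A × Bool) : ℝ≥0∞) = ENNReal.ofReal T :=
    (ENNReal.ofReal_natCast _).symm
  have cX : (Fintype.card (A × Bool) : ℝ≥0∞) = ENNReal.ofReal (m * 2) := by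
    rw [← ENNReal.ofReal_natCast, Fintype.card_prod]
    simp [m]
  -- `1 / 16` from policies in `B θ` and `1 / 240` from failure add up to `1 / 15`.
  have hmiss : ∑ i : F.Bandit, ∑ θ, F.missArm L N h1 θ i ≤ ENNReal.ofReal (T * (n / 15)) := by
    rw [Finset.sum_comm]
    calc _ ≤ ∑ θ : S → A × Bool, ENNReal.ofReal (n / 15) := by
          refine Finset.sum_le_sum fun θ _ => (F.sum_missArm_le L N h1 θ (B θ)
            (c := ENNReal.ofReal (n / 16)) fun π hπ => ?_).trans ?_
          · rw [← ENNReal.ofReal_natCast]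
            refine ENNReal.ofReal_le_ofReal ?_
            have : (16 : ℝ) * (F.missed θ h1 π).card ≤ n := by
              simp only [n]
              exact_mod_cast hB θ π hπ
            linarith
          · rw [cn]
            calc _ ≤ ENNReal.ofReal (n / 16) + ENNReal.ofReal n * ENNReal.ofReal (1 / 240) := by
                  gcongr
                  exact hcompl θ
              _ = ENNReal.ofReal (n / 15) := by
                  rw [← ENNReal.ofReal_mul hn.le, ← ENNReal.ofReal_add (by positivity)
                    (by positivity)]
                  congr 1
                  ring
      _ = _ := by
          rw [Finset.sum_const, Finset.card_univ, nsmul_eq_mul, cT, ENNReal.ofReal_mul hT.le]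
  have hpull : ∑ i : F.Bandit, ∑ θ, F.expPulls L N θ i ≤ ENNReal.ofReal (T * b) := by
    rw [Finset.sum_comm]
    calc _ ≤ ∑ θ : S → A × Bool, ENNReal.ofReal b := by
          refine Finset.sum_le_sum fun θ _ => (F.sum_expPulls_le L N θ).trans ?_
          exact (L.expect_length_le_expNumEpisodes _ N).trans (hcon θ).le
      _ = _ := by
          rw [Finset.sum_const, Finset.card_univ, nsmul_eq_mul, cT, ENNReal.ofReal_mul hT.le]
  have h := Finset.sum_le_sum fun (i : F.Bandit) (_ : i ∈ Finset.univ) =>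
    F.sum_card_mul_card_le L N h1 i
  simp only [Finset.sum_add_distrib, Finset.sum_const, Finset.card_univ, nsmul_eq_mul,
    ← Finset.mul_sum] at h
  rw [cn, cm, cT, cX, show (2 : ℝ≥0∞) = ENNReal.ofReal 2 by simp] at h
  have hreal : n * (T * (m * m)) ≤ n * (T * m) + 2 * m * (m * 2 * (T * (n / 15))) +
      5 * (F.gap : ℝ) ^ 2 * (m * 2 * (T * b)) := by
    refine (ENNReal.ofReal_le_ofReal_iff (by positivity)).1 ?_
    calc _ = ENNReal.ofReal n * (ENNReal.ofReal T * (ENNReal.ofReal m * ENNReal.ofReal m)) := by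
          rw [ENNReal.ofReal_mul hn.le, ENNReal.ofReal_mul hT.le, ENNReal.ofReal_mul (by linarith)]
      _ ≤ _ := h
      _ ≤ ENNReal.ofReal n * (ENNReal.ofReal T * ENNReal.ofReal m) + ENNReal.ofReal 2 *
          ENNReal.ofReal m * (ENNReal.ofReal (m * 2) * ENNReal.ofReal (T * (n / 15))) +
          ENNReal.ofReal (5 * (F.gap : ℝ) ^ 2) *
            (ENNReal.ofReal (m * 2) * ENNReal.ofReal (T * b)) := by gcongr
      _ = _ := by
          rw [← ENNReal.ofReal_mul (by positivity), ← ENNReal.ofReal_mul (by positivity),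
            ← ENNReal.ofReal_mul (by positivity), ← ENNReal.ofReal_mul (by positivity),
            ← ENNReal.ofReal_mul (by positivity), ← ENNReal.ofReal_mul (by positivity),
            ← ENNReal.ofReal_mul (by positivity), ← ENNReal.ofReal_add (by positivity)
              (by positivity), ← ENNReal.ofReal_add (by positivity) (by positivity)]
  have hbv : (F.gap : ℝ) ^ 2 * b = n * (m - 1) / 40 := by
    simp only [b]
    field_simp
  -- After cancellation this forces `29 * m ≤ 45`, which contradicts `2 ≤ m`.
  have hfac : (n * T * m) * m ≤ (n * T * m) * (1 + 4 * m / 15 + (m - 1) / 4) := by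
    calc _ = n * (T * (m * m)) := by ring
      _ ≤ _ := hreal
      _ = n * (T * m) + 2 * m * (m * 2 * (T * (n / 15))) +
          10 * m * T * ((F.gap : ℝ) ^ 2 * b) := by ring
      _ = _ := by rw [hbv]; ring
  have := le_of_mul_le_mul_left hfac (by positivity)
  linarith

end BanditFamily

/-! ### Constants and the final theorem. -/

/-- The summand `exp (-4) / 80` keeps the denominator away from `0`: the argument is at most `320 *
exp 4`, and `320 ≤ exp 6`. -/
theorem log_confidence_le {δ : ℝ} (hδ : 0 < δ) :
    Real.log (4 / (δ + Real.exp (-4) / 80)) ≤ 10 := by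
  have he := Real.exp_pos (-4)
  refine (Real.log_le_iff_le_exp (by positivity)).2 ?_
  rw [div_le_iff₀ (by positivity)]
  have h6 : (400 : ℝ) ≤ Real.exp 6 := by
    have h1 := Real.exp_one_gt_d9
    have : Real.exp 6 = Real.exp 1 ^ 6 := by rw [← Real.exp_nat_mul]; norm_num
    rw [this]
    calc (400 : ℝ) ≤ 2.718 ^ 6 := by norm_num
      _ ≤ _ := by gcongr; linarith
  have h10 : Real.exp 10 * Real.exp (-4) = Real.exp 6 := by rw [← Real.exp_add]; norm_num
  nlinarith [Real.exp_pos 10]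

theorem theorem2 :
    ∃ c₁ c₁' : ℝ, 0 < c₁ ∧ 0 < c₁' ∧
      ∀ (S : Type u) (A : Type v) [Fintype S] [Fintype A] [Nonempty S] [Nonempty A]
        (H : ℕ) (ε δ : ℝ),
        0 < δ → δ < Real.exp (-4) / 80 →
        0 < ε → ε < ((H : ℝ) - 2) / (640 * Real.exp 4) →
        ∀ alg : Algorithm S A H, alg.IsPAC ε δ →
          ∃ M : FHMDP S A H,
            (4 ≤ Fintype.card S → M.IsParallelBandits) ∧
            ENNReal.ofReal
                (c₁ * ((H : ℝ) - 2) ^ 2 * ((Fintype.card A : ℝ) - 1) * ((Fintype.card S : ℝ) - 3)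
                  / ε ^ 2 * Real.log (4 / (δ + Real.exp (-4) / 80)))
              ≤ (alg M.r M.p0).expNumEpisodes M ∧
            (4 ≤ Fintype.card S → 2 ≤ Fintype.card A →
              ENNReal.ofReal
                  (c₁' * ((Fintype.card S : ℝ) * (Fintype.card A : ℝ)) * (H : ℝ) ^ 2
                    / ε ^ 2 * Real.log (4 / (δ + Real.exp (-4) / 80)))
                ≤ (alg M.r M.p0).expNumEpisodes M) := by
  -- `102400 = 40 * 16 ^ 2 * 10`: the constant of `exists_le_expNumEpisodes`, the squared factor in
  -- the gap, and the bound on the logarithm. `72 = 4 * 2 * 3 ^ 2` comes from `s ≤ 4 * (s - 3)`, `a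
  -- ≤ 2 * (a - 1)` and `k ≤ 3 * (k - 2)`.
  refine ⟨1 / 102400, 1 / 102400 / 72, by norm_num, by norm_num, ?_⟩
  intro S A _ _ _ _ H ε δ hδ hδ' hε hε' alg hPAC
  have he4 : Real.exp (-4) ≤ 1 / 5 := by
    have := Real.add_one_le_exp (4 : ℝ)
    rw [Real.exp_neg, inv_eq_one_div]
    gcongr
    linarith
  have hE4 : (5 : ℝ) ≤ Real.exp 4 := by
    have := Real.add_one_le_exp (4 : ℝ)
    linarith
  rw [lt_div_iff₀ (by positivity)] at hε'
  have hH2 : (0 : ℝ) < (H : ℝ) - 2 := lt_of_le_of_lt (by positivity) hε'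
  have hH : 3 ≤ H := by
    have : (2 : ℝ) < H := by linarith
    exact_mod_cast this
  have hH' : (3 : ℝ) ≤ H := by exact_mod_cast hH
  have h1 : 1 < H := by omega
  have hlog := log_confidence_le hδ
  have hlog0 : 0 ≤ Real.log (4 / (δ + Real.exp (-4) / 80)) := by
    refine Real.log_nonneg ((one_le_div (by positivity)).2 ?_)
    linarith
  set l := Real.log (4 / (δ + Real.exp (-4) / 80))
  have hA1 : (1 : ℝ) ≤ Fintype.card A := by
    exact_mod_cast (Fintype.card_pos : 0 < Fintype.card A)
  by_cases hS : 4 ≤ Fintype.card S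
  swap
  -- Any MDP will do, since the factor `|S| - 3` makes the bound nonpositive.
  · refine ⟨⟨fun _ _ => 0, by simp, by simp, fun s _ => PMF.pure s,
      PMF.pure (Classical.arbitrary S)⟩, fun h => absurd h hS, ?_, fun h => absurd h hS⟩
    rw [ENNReal.ofReal_of_nonpos]
    · exact zero_le
    · have hS3 : (Fintype.card S : ℝ) ≤ 3 := by exact_mod_cast (by omega : Fintype.card S ≤ 3)
      refine mul_nonpos_of_nonpos_of_nonneg (div_nonpos_of_nonpos_of_nonneg ?_ (by positivity)) hlog0
      refine mul_nonpos_of_nonneg_of_nonpos (mul_nonneg (by positivity) ?_) ?_ <;> linarith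
  obtain ⟨F, hF⟩ : ∃ F : BanditFamily S, (F.gap : ℝ) = 16 * ε / ((H : ℝ) - 2) := by
    obtain ⟨e⟩ : Nonempty (Fin 4 ↪ S) :=
      Function.Embedding.nonempty_of_card_le (by simpa using hS)
    have hne : ∀ i j : Fin 4, i ≠ j → e i ≠ e j := fun i j h h' => h (e.injective h')
    refine ⟨⟨e 0, e 1, e 2, hne _ _ (by decide), hne _ _ (by decide), hne _ _ (by decide),
      (16 * ε / ((H : ℝ) - 2)).toNNReal, ?_,
      e 3, hne _ _ (by decide), hne _ _ (by decide), hne _ _ (by decide)⟩,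
      Real.coe_toNNReal _ (by positivity)⟩
    rw [← NNReal.coe_le_coe, Real.coe_toNNReal _ (by positivity)]
    push_cast
    rw [div_le_iff₀ hH2]
    nlinarith
  have hgap : 0 < F.gap := by
    rw [← NNReal.coe_pos, hF]
    positivity
  by_cases hA : 2 ≤ Fintype.card A
  swap
  -- With a single action the factor `|A| - 1` is zero.
  · refine ⟨F.mdp H fun _ => (Classical.arbitrary A, false),
      fun _ => F.isParallelBandits_mdp _, ?_, fun _ h => absurd h hA⟩
    have : (Fintype.card A : ℝ) = 1 := by
      exact_mod_cast (by have := Fintype.card_pos (α := A); omega : Fintype.card A = 1)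
    simp [this]
  have hmem : ∀ θ, ∀ π ∈ {π : DetPolicy S A H | (F.mdp H θ).IsEpsOptimal ε π},
      16 * (F.missed θ h1 π).card ≤ Fintype.card F.Bandit := by
    intro θ π hπ
    have h := F.card_missed_le θ h1 hπ
    rw [hF, mul_div_cancel₀ _ hH2.ne', mul_comm (16 : ℝ) ε, mul_assoc] at h
    exact_mod_cast le_of_mul_le_mul_left h hε
  -- Rewards and initial law do not depend on `θ`, so `θ₀` only serves to name the common learner.
  let θ₀ : S → A × Bool := fun _ => (Classical.arbitrary A, false)
  obtain ⟨θ, hθ⟩ := F.exists_le_expNumEpisodes (alg (F.mdp H θ₀).r (F.mdp H θ₀).p0) h1 hgap hA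
    (fun θ => {π | (F.mdp H θ).IsEpsOptimal ε π}) hmem (δ := δ) (by linarith)
    (fun θ => hPAC (F.mdp H θ))
  have hbound : (Fintype.card F.Bandit : ℝ) * ((Fintype.card A : ℝ) - 1) /
      (40 * (F.gap : ℝ) ^ 2) = 1 / 10240 * (((H : ℝ) - 2) ^ 2 * ((Fintype.card A : ℝ) - 1) *
        ((Fintype.card S : ℝ) - 3) / ε ^ 2) := by
    rw [hF, F.card_bandit_real]
    field_simp
    ring
  rw [hbound] at hθ
  have hS' : (4 : ℝ) ≤ Fintype.card S := by exact_mod_cast hS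
  have hA' : (2 : ℝ) ≤ Fintype.card A := by exact_mod_cast hA
  generalize hs : (Fintype.card S : ℝ) = s at *
  generalize ha : (Fintype.card A : ℝ) = a at *
  generalize hk : (H : ℝ) = k at *
  have hq : 0 ≤ (k - 2) ^ 2 * (a - 1) * (s - 3) := by
    have : 0 ≤ a - 1 := by linarith
    have : 0 ≤ s - 3 := by linarith
    positivity
  refine ⟨F.mdp H θ, fun _ => F.isParallelBandits_mdp θ, ?_, fun _ _ => ?_⟩
  · refine le_trans (ENNReal.ofReal_le_ofReal ?_) hθ
    calc _ = 1 / 102400 * ((k - 2) ^ 2 * (a - 1) * (s - 3) / ε ^ 2) * l := by ring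
      _ ≤ 1 / 102400 * ((k - 2) ^ 2 * (a - 1) * (s - 3) / ε ^ 2) * 10 := by gcongr
      _ = _ := by ring
  · refine le_trans (ENNReal.ofReal_le_ofReal ?_) hθ
    have hcmp : s * a * k ^ 2 ≤ 72 * ((k - 2) ^ 2 * (a - 1) * (s - 3)) := by
      calc s * a * k ^ 2 ≤ (4 * (s - 3)) * (2 * (a - 1)) * (3 * (k - 2)) ^ 2 := by
            have : 0 ≤ a - 1 := by linarith
            have : 0 ≤ s - 3 := by linarith
            gcongr <;> linarith
        _ = _ := by ring
    calc _ = 1 / 102400 / 72 * (s * a * k ^ 2 / ε ^ 2) * l := by ring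
      _ ≤ 1 / 102400 / 72 * (72 * ((k - 2) ^ 2 * (a - 1) * (s - 3)) / ε ^ 2) * 10 := by gcongr
      _ = _ := by ring
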